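/- For a set $A\subset\mathbb{R}^d$ and $r>0$ let $N_r(A)$ be the least number of sets of diameter at most $r$ that can cover $A$. For bounded $A$ let $\underline{\dim}_B A=\liminf_{r\to0^+}\frac{\log N_r(A)}{-\log r}$ be the lower box-counting dimension, and for $E\subset\mathbb{R}^d$ let $$\underline{\dim}_{MB}E=\inf\Big\{\sup_i\ \underline{\dim}_B E_i:\ E\subset\bigcup_{i=1}^\infty E_i,\ \text{each } E_i \text{ compact}\Big\}$$ be the modified lower box dimension. Write $B(x,r)$ for the closed ball with centre $x$ and radius $r$, and $\{r_k\}\searrow0$ for a sequence of positive numbers decreasing to $0$. Write $\operatorname{spt}\mu$ for the (closed) support of a Borel measure $\mu$ on $\mathbb{R}^d$. Values are taken in $[-\infty,\infty]$, with $\log 0=-\infty$, $\log\infty=\infty$ and $\sup\emptyset=-\infty$ (so the empty set has dimension $-\infty$). **Theorem.** Let $E\subset\mathbb{R}^d$ be compact. Then $\underline{\dim}_{MB}E$ is the supremum of the real numbers $s\ge 0$ for which there is a non-empty set $F\subset E$ with the following property: for every sequence $\{r_k\}\searrow0$ there are a subsequence $\{r_{k_i}\}_i$ and a Borel measure $\mu$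 on $\mathbb{R}^d$ with $\operatorname{spt}\mu=F$ such that $\mu(B(x,r_{k_i}))\le r_{k_i}^s$ for all $x\in\mathbb{R}^d$ and all $i\in\mathbb{N}$. Moreover, $$\underline{\dim}_{MB}E=\sup_{\emptyset\ne F\subset E}\ \inf_{\{r_k\}\searrow0}\ \sup_{\mu:\,\operatorname{spt}\mu=F}\ \limsup_{k\to\infty}\ \inf_{x\in E}\frac{\log\mu(B(x,r_k))}{\log r_k},$$ where $\mu$ ranges over the Borel measures on $\mathbb{R}^d$. -/

import Mathlib

open Set Filter Topology MeasureTheory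

noncomputable section

/-- `coverNum r E` is the least number of sets of diameter at most `r` that can cover `E`
(it is `⊤` when no finite cover exists). -/
def coverNum {X : Type*} [PseudoEMetricSpace X] (r : ℝ) (E : Set X) : ℕ∞ :=
  ⨅ (U : Finset (Set X))
    (_ : (∀ V ∈ U, Metric.ediam V ≤ ENNReal.ofReal r) ∧ E ⊆ ⋃ V ∈ U, V),
    (U.card : ℕ∞)

/-- The lower box-counting dimension `liminf_{r → 0+} log N_r(E) / (-log r)`, with
`log 0 = -∞`, so that the empty set has dimension `-∞`. -/
def lowerBoxDim {X : Type*} [PseudoEMetricSpace X] (E : Set X) : EReal :=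
  liminf (fun r : ℝ => ENNReal.log ((coverNum r E : ℕ∞) : ENNReal) / ((-Real.log r : ℝ) : EReal))
    (𝓝[>] (0 : ℝ))

/-- The modified lower box dimension: the infimum, over all countable covers of `E` by compact
sets, of the supremum of the lower box dimensions of the covering sets. -/
def modifiedLowerBoxDim {X : Type*} [PseudoEMetricSpace X] (E : Set X) : EReal :=
  ⨅ (C : ℕ → Set X) (_ : (∀ i, IsCompact (C i)) ∧ E ⊆ ⋃ i, C i), ⨆ i, lowerBoxDim (C i)

/-- `r` is a sequence of positive numbers decreasing to `0`. -/
def DecreasesToZero (r : ℕ → ℝ) : Prop :=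
  (∀ k, 0 < r k) ∧ Antitone r ∧ Tendsto r atTop (𝓝 0)

end

/-! The three quantities are equal because they are bounded by one another in a cycle.

Dimension at most the Frostman supremum: if `t` is below the dimension of `E`, deleting the points
with a neighbourhood that is a countable union of pieces of lower box dimension at most `t` leaves a
compact kernel `F` whose portions all have lower box dimension above `t` (`exists_kernel`). By
compactness, at every small scale each point of `F` has about `r ^ (-t)` separated points of `F`
nearby (`eventually_exists_separated`). Along a sparse subsequence of the given scales, a random
walk jumps uniformly among these points or stays put. The law of its limit gives small mass to balls
and charges every neighbourhood of the start (`exists_measure_of_separated`). Averaging over a dense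
set of starts makes the support all of `F`.

Frostman supremum at most the local one: take logarithms; infinitely many good scales suffice for a
limsup.

Local supremum at most the dimension: by Baire, some piece of a compact cover contains a portion of
`F`. Along scales where that piece has few covering sets, the Frostman bound would force the
portion's mass to be arbitrarily small, yet it is positive (`le_modifiedLowerBoxDim`). -/

namespace ModifiedBoxDim

/-! ### Logarithmic quotients as power inequalities -/

lemma coe_mul_neg_log {r : ℝ} (hr : 0 < r) (s : ℝ) :
    (s : EReal) * ((-Real.log r : ℝ) : EReal) = ENNReal.log (ENNReal.ofReal (r ^ (-s))) := by
  rw [ENNReal.log_ofReal_of_pos (Real.rpow_pos_of_pos hr _), Real.log_rpow hr, ← EReal.coe_mul]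
  congr 1
  ring

lemma neg_log_pos {r : ℝ} (hr : 0 < r) (hr1 : r < 1) : (0 : EReal) < ((-Real.log r : ℝ) : EReal) := by
  have := Real.log_neg hr hr1
  exact_mod_cast (by linarith : 0 < -Real.log r)

lemma lt_log_div_neg_log_iff {r s : ℝ} {a : ENNReal} (hr : 0 < r) (hr1 : r < 1) :
    (s : EReal) < ENNReal.log a / ((-Real.log r : ℝ) : EReal) ↔ ENNReal.ofReal (r ^ (-s)) < a := by
  rw [EReal.lt_div_iff (neg_log_pos hr hr1) (EReal.coe_ne_top _), coe_mul_neg_log hr,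
    ENNReal.log_lt_log_iff]

lemma le_log_div_neg_log_iff {r s : ℝ} {a : ENNReal} (hr : 0 < r) (hr1 : r < 1) :
    (s : EReal) ≤ ENNReal.log a / ((-Real.log r : ℝ) : EReal) ↔ ENNReal.ofReal (r ^ (-s)) ≤ a := by
  rw [EReal.le_div_iff_mul_le (neg_log_pos hr hr1) (EReal.coe_ne_top _), coe_mul_neg_log hr,
    ENNReal.log_le_log_iff]

lemma le_log_div_log_iff {r s : ℝ} {a : ENNReal} (hr : 0 < r) (hr1 : r < 1) :
    (s : EReal) ≤ ENNReal.log a / ((Real.log r : ℝ) : EReal) ↔ a ≤ ENNReal.ofReal (r ^ s) := by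
  -- Passing to `a⁻¹` makes the denominator positive, including when `a` is `0` or `⊤`.
  have h : ENNReal.log a / ((Real.log r : ℝ) : EReal)
      = ENNReal.log a⁻¹ / ((-Real.log r : ℝ) : EReal) := by
    rw [ENNReal.log_inv, div_eq_mul_inv, div_eq_mul_inv, ← EReal.coe_inv, ← EReal.coe_inv, inv_neg,
      EReal.coe_neg, EReal.neg_mul, mul_neg, neg_neg]
  rw [h, le_log_div_neg_log_iff hr hr1, Real.rpow_neg hr.le,
    ENNReal.ofReal_inv_of_pos (Real.rpow_pos_of_pos hr _), ENNReal.inv_le_inv]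

/-! ### Covering numbers and lower box dimension -/

section Covering

variable {X : Type*} [PseudoEMetricSpace X]

lemma coverNum_le_card {r : ℝ} {A : Set X} (U : Finset (Set X))
    (hU : ∀ V ∈ U, Metric.ediam V ≤ ENNReal.ofReal r) (hA : A ⊆ ⋃ V ∈ U, V) :
    coverNum r A ≤ U.card :=
  iInf₂_le U ⟨hU, hA⟩

lemma coverNum_mono {r : ℝ} {A B : Set X} (h : A ⊆ B) : coverNum r A ≤ coverNum r B :=
  le_iInf₂ fun U hU => coverNum_le_card U hU.1 (h.trans hU.2)

lemma exists_cover_card_lt {r : ℝ} {A : Set X} {a : ENNReal}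
    (h : ((coverNum r A : ℕ∞) : ENNReal) < a) :
    ∃ U : Finset (Set X), (∀ V ∈ U, Metric.ediam V ≤ ENNReal.ofReal r) ∧ A ⊆ ⋃ V ∈ U, V ∧
      (U.card : ENNReal) < a := by
  by_contra! hcon
  have hne : coverNum r A ≠ ⊤ := by
    intro htop
    rw [htop] at h
    simp at h
  obtain ⟨n, hn⟩ := ENat.ne_top_iff_exists.mp hne
  have hlt : coverNum r A < (n + 1 : ℕ) := by
    rw [← hn]
    exact_mod_cast Nat.lt_succ_self n
  obtain ⟨U, hU, hcard⟩ : ∃ U : Finset (Set X), ∃ _ : (∀ V ∈ U, Metric.ediam V ≤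
      ENNReal.ofReal r) ∧ A ⊆ ⋃ V ∈ U, V, (U.card : ℕ∞) < (n + 1 : ℕ) := by
    simpa only [coverNum, iInf_lt_iff] using hlt
  have hle : U.card ≤ n := Nat.lt_succ_iff.mp (by exact_mod_cast hcard)
  have h1 := hcon U hU.1 hU.2
  rw [← hn] at h
  have h2 : (U.card : ENNReal) ≤ n := by exact_mod_cast hle
  exact absurd (h.trans_le (h1.trans h2)) (by simp)

@[simp] lemma coverNum_empty (r : ℝ) : coverNum r (∅ : Set X) = 0 := by
  have := coverNum_le_card (r := r) (A := (∅ : Set X)) ∅ (by simp) (by simp)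
  simpa using this

lemma eventually_Ioo_nhdsGT : ∀ᶠ r : ℝ in 𝓝[>] 0, r ∈ Ioo (0 : ℝ) 1 :=
  Ioo_mem_nhdsGT one_pos

@[simp] lemma lowerBoxDim_empty : lowerBoxDim (∅ : Set X) = ⊥ := by
  have h : (fun r : ℝ => ENNReal.log ((coverNum r (∅ : Set X) : ℕ∞) : ENNReal) /
      ((-Real.log r : ℝ) : EReal)) =ᶠ[𝓝[>] (0 : ℝ)] fun _ => ⊥ := by
    filter_upwards [eventually_Ioo_nhdsGT] with r hr
    simp only [coverNum_empty, ENat.toENNReal_zero, ENNReal.log_zero]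
    exact EReal.bot_div_of_pos_ne_top (neg_log_pos hr.1 hr.2) (EReal.coe_ne_top _)
  rw [lowerBoxDim, liminf_congr h, liminf_const]

lemma eventually_rpow_lt_coverNum {A : Set X} {t : ℝ} (h : (t : EReal) < lowerBoxDim A) :
    ∀ᶠ r : ℝ in 𝓝[>] 0, ENNReal.ofReal (r ^ (-t)) < ((coverNum r A : ℕ∞) : ENNReal) := by
  filter_upwards [eventually_lt_of_lt_liminf h, eventually_Ioo_nhdsGT] with r hr hr1
  exact (lt_log_div_neg_log_iff hr1.1 hr1.2).mp hr

lemma frequently_coverNum_lt_rpow {A : Set X} {t : ℝ} (h : lowerBoxDim A < t) :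
    ∃ᶠ r : ℝ in 𝓝[>] 0, ((coverNum r A : ℕ∞) : ENNReal) < ENNReal.ofReal (r ^ (-t)) := by
  refine ((frequently_lt_of_liminf_lt (by isBoundedDefault) h).and_eventually
    eventually_Ioo_nhdsGT).mono fun r hr => ?_
  have := hr.1
  rw [← not_le] at this ⊢
  exact fun h' => this ((le_log_div_neg_log_iff hr.2.1 hr.2.2).mpr h')

lemma modifiedLowerBoxDim_empty : modifiedLowerBoxDim (∅ : Set X) = ⊥ := by
  refine le_bot_iff.mp (iInf₂_le_of_le (fun _ => ∅) ⟨fun _ => isCompact_empty, by simp⟩ ?_)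
  simp

end Covering

/-! ### Sequences of scales and a Baire argument -/

lemma exists_decreasesToZero_of_frequently {P : ℝ → Prop} (h : ∃ᶠ r in 𝓝[>] (0 : ℝ), P r) :
    ∃ r : ℕ → ℝ, DecreasesToZero r ∧ ∀ k, P (r k) := by
  obtain ⟨u, hu, hP⟩ := exists_seq_forall_of_frequently
    (h.and_eventually (self_mem_nhdsWithin : ∀ᶠ r in 𝓝[>] (0 : ℝ), r ∈ Ioi (0 : ℝ)))
  obtain ⟨φ, hφ, hmono⟩ := strictMono_subseq_of_tendsto_atTop (tendsto_inv_nhdsGT_zero.comp hu)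
  refine ⟨u ∘ φ, ⟨fun k => (hP _).2, fun i j hij => ?_, ?_⟩, fun k => (hP _).1⟩
  · exact (inv_le_inv₀ (hP _).2 (hP _).2).mp (hmono.monotone hij)
  · exact (hu.mono_right nhdsWithin_le_nhds).comp hφ.tendsto_atTop

lemma _root_.DecreasesToZero.tendsto_nhdsGT {r : ℕ → ℝ} (h : DecreasesToZero r) :
    Tendsto r atTop (𝓝[>] 0) :=
  tendsto_nhdsWithin_iff.mpr ⟨h.2.2, Eventually.of_forall h.1⟩

lemma tendsto_ofReal_rpow_nhdsGT {a : ℝ} (ha : 0 < a) :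
    Tendsto (fun r : ℝ => ENNReal.ofReal (r ^ a)) (𝓝[>] 0) (𝓝 0) := by
  have h := ((Real.continuousAt_rpow_const 0 a (Or.inr ha.le)).tendsto).mono_left
    (nhdsWithin_le_nhds (s := Ioi 0))
  rw [Real.zero_rpow ha.ne'] at h
  simpa using ENNReal.tendsto_ofReal h

lemma exists_isOpen_inter_subset_of_subset_iUnion {X : Type*} [MetricSpace X] {F : Set X} (hF : IsCompact F)
    (hne : F.Nonempty) {C : ℕ → Set X} (hC : ∀ i, IsClosed (C i)) (hFC : F ⊆ ⋃ i, C i) :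
    ∃ i, ∃ U, IsOpen U ∧ (U ∩ F).Nonempty ∧ U ∩ F ⊆ C i := by
  have : CompactSpace F := isCompact_iff_compactSpace.mp hF
  have : Nonempty F := hne.to_subtype
  obtain ⟨i, x, hx⟩ := nonempty_interior_of_iUnion_of_closed
    (f := fun i => ((↑) : F → X) ⁻¹' C i) (fun i => (hC i).preimage continuous_subtype_val)
    (by
      rw [← preimage_iUnion]
      exact eq_univ_of_forall fun x => hFC x.2)
  obtain ⟨V, hVsub, hV, hxV⟩ := mem_interior.mp hx
  obtain ⟨U, hU, rfl⟩ := isOpen_induced_iff.mp hV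
  exact ⟨i, U, hU, ⟨x, hxV, x.2⟩, fun y hy => hVsub (a := ⟨y, hy.2⟩) hy.1⟩

/-! ### Mass distribution principle -/

section LowerBound

variable {X : Type*} [MetricSpace X] [MeasurableSpace X]

/-- A covering set that meets `A` lies in a ball of radius `r` about a point of `A`, so bounds for
centres in `E` suffice. -/
lemma measure_le_card_mul {μ : Measure X} {A E : Set X} {r : ℝ} (hr : 0 ≤ r) {b : ENNReal}
    (hAE : A ⊆ E) (hb : ∀ x ∈ E, μ (Metric.closedBall x r) ≤ b) {U : Finset (Set X)}
    (hU : ∀ V ∈ U, Metric.ediam V ≤ ENNReal.ofReal r) (hA : A ⊆ ⋃ V ∈ U, V) :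
    μ A ≤ U.card * b := by
  have h1 : A ⊆ ⋃ V ∈ U, V ∩ A := fun x hx => by
    have := hA hx
    simp only [mem_iUnion, exists_prop] at this ⊢
    obtain ⟨V, hV, hxV⟩ := this
    exact ⟨V, hV, hxV, hx⟩
  have h2 : ∀ V ∈ U, μ (V ∩ A) ≤ b := fun V hV => by
    rcases (V ∩ A).eq_empty_or_nonempty with h | ⟨x, hxV, hxA⟩
    · simp [h]
    · refine (measure_mono fun y hy => ?_).trans (hb x (hAE hxA))
      rw [Metric.mem_closedBall, ← ENNReal.ofReal_le_ofReal_iff hr, ← edist_dist]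
      exact (Metric.edist_le_ediam_of_mem hy.1 hxV).trans (hU V hV)
  calc μ A ≤ μ (⋃ V ∈ U, V ∩ A) := measure_mono h1
    _ ≤ ∑ V ∈ U, μ (V ∩ A) := measure_biUnion_finset_le _ _
    _ ≤ ∑ _V ∈ U, b := Finset.sum_le_sum h2
    _ = U.card * b := by simp

lemma measure_inter_pos_of_mem_support [HereditarilyLindelofSpace X] {μ : Measure X} {F U : Set X}
    (hF : μ.support = F) (hU : IsOpen U) {x : X} (hxU : x ∈ U) (hxF : x ∈ F) : 0 < μ (U ∩ F) := by
  rw [measure_inter_conull (hF ▸ Measure.measure_compl_support)]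
  exact (Measure.mem_support_iff_forall x).mp (hF ▸ hxF) U (hU.mem_nhds hxU)

/-- A mass distribution principle: if along every sequence of scales some measure with support `F`
satisfies a Frostman condition of exponent `s` at infinitely many scales, then `s` bounds the
modified lower box dimension from below. -/
theorem le_modifiedLowerBoxDim [HereditarilyLindelofSpace X] {E F : Set X} (hE : IsCompact E)
    (hFE : F ⊆ E) (hne : F.Nonempty) {s : ℝ}
    (h : ∀ r : ℕ → ℝ, DecreasesToZero r → ∃ μ : Measure X, μ.support = F ∧
      ∃ᶠ k in atTop, ∀ x ∈ E, μ (Metric.closedBall x (r k)) ≤ ENNReal.ofReal (r k ^ s)) :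
    (s : EReal) ≤ modifiedLowerBoxDim E := by
  have hFclosed : IsClosed F := by
    obtain ⟨r, hr, -⟩ := exists_decreasesToZero_of_frequently (P := fun _ => True)
      (frequently_true_iff_neBot _ |>.mpr inferInstance)
    obtain ⟨μ, hμ, -⟩ := h r hr
    exact hμ ▸ Measure.isClosed_support
  refine le_iInf₂ fun C hC => ?_
  obtain ⟨i, U, hU, ⟨x, hxU, hxF⟩, hUC⟩ := exists_isOpen_inter_subset_of_subset_iUnion
    (hE.of_isClosed_subset hFclosed hFE) hne (fun i => (hC.1 i).isClosed) (hFE.trans hC.2)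
  refine le_trans ?_ (le_iSup (fun i => lowerBoxDim (C i)) i)
  by_contra! hlt
  obtain ⟨t, ht, hts⟩ := EReal.lt_iff_exists_real_btwn.mp hlt
  have hts : t < s := by exact_mod_cast hts
  -- These scales depend on the piece `C i` and are fixed before `μ`, which is why every sequence
  -- must be allowed.
  obtain ⟨r, hr, hcov⟩ := exists_decreasesToZero_of_frequently (frequently_coverNum_lt_rpow ht)
  obtain ⟨μ, hμ, hfreq⟩ := h r hr
  have hpos := measure_inter_pos_of_mem_support hμ hU hxU hxF
  have hsmall := ((tendsto_ofReal_rpow_nhdsGT (sub_pos.mpr hts)).comp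
    hr.tendsto_nhdsGT).eventually_lt_const hpos
  obtain ⟨k, hk, hk'⟩ := (hfreq.and_eventually hsmall).exists
  obtain ⟨W, hW, hCW, hcard⟩ := exists_cover_card_lt (hcov k)
  refine absurd hk' (not_lt.mpr ?_)
  calc μ (U ∩ F) ≤ W.card * ENNReal.ofReal (r k ^ s) :=
        measure_le_card_mul (hr.1 k).le (inter_subset_right.trans hFE) hk hW (hUC.trans hCW)
    _ ≤ ENNReal.ofReal (r k ^ (-t)) * ENNReal.ofReal (r k ^ s) := by gcongr
    _ = ENNReal.ofReal (r k ^ (s - t)) := by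
        rw [← ENNReal.ofReal_mul (Real.rpow_nonneg (hr.1 k).le _), ← Real.rpow_add (hr.1 k)]
        ring_nf

end LowerBound

/-! ### The kernel of large portions -/

section Kernel

variable {X : Type*} [MetricSpace X]

/-- `A` is covered by countably many compact sets of lower box dimension at most `t`. -/
def SigmaBoxDimLE (t : ℝ) (A : Set X) : Prop :=
  ∃ S : Set (Set X), S.Countable ∧ (∀ C ∈ S, IsCompact C ∧ lowerBoxDim C ≤ t) ∧ A ⊆ ⋃₀ S

lemma SigmaBoxDimLE.mono {t : ℝ} {A B : Set X} (hAB : A ⊆ B) (hB : SigmaBoxDimLE t B) :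
    SigmaBoxDimLE t A :=
  let ⟨S, hS, hC, hBS⟩ := hB
  ⟨S, hS, hC, hAB.trans hBS⟩

lemma SigmaBoxDimLE.sUnion {t : ℝ} {T : Set (Set X)} (hT : T.Countable)
    (h : ∀ A ∈ T, SigmaBoxDimLE t A) : SigmaBoxDimLE t (⋃₀ T) := by
  choose! S hS hC hAS using h
  refine ⟨⋃ A ∈ T, S A, hT.biUnion hS, fun C hCmem => ?_, sUnion_subset fun A hA x hx => ?_⟩
  · obtain ⟨A, hA, hCA⟩ := mem_iUnion₂.mp hCmem
    exact hC A hA C hCA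
  · obtain ⟨C, hCA, hxC⟩ := hAS A hA hx
    exact ⟨C, mem_biUnion hA hCA, hxC⟩

lemma SigmaBoxDimLE.union {t : ℝ} {A B : Set X} (hA : SigmaBoxDimLE t A)
    (hB : SigmaBoxDimLE t B) : SigmaBoxDimLE t (A ∪ B) := by
  rw [← sUnion_pair]
  exact SigmaBoxDimLE.sUnion (by simp) (by simp [hA, hB])

lemma sigmaBoxDimLE_of_isCompact {t : ℝ} {A : Set X} (hA : IsCompact A) (h : lowerBoxDim A ≤ t) :
    SigmaBoxDimLE t A :=
  ⟨{A}, countable_singleton A, by simp [hA, h], by simp⟩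

lemma SigmaBoxDimLE.modifiedLowerBoxDim_le {t : ℝ} {A : Set X} (h : SigmaBoxDimLE t A) :
    modifiedLowerBoxDim A ≤ t := by
  obtain ⟨S, hS, hC, hAS⟩ := h
  -- Adding `∅`, of dimension `⊥`, makes the family non-empty and hence enumerable by `ℕ`.
  obtain ⟨C, hCr⟩ := (hS.insert ∅).exists_eq_range (insert_nonempty _ _)
  have hmem : ∀ i, IsCompact (C i) ∧ lowerBoxDim (C i) ≤ t := fun i => by
    rcases (hCr ▸ mem_range_self i : C i ∈ insert ∅ S) with h | h
    · simp [h]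
    · exact hC _ h
  refine iInf₂_le_of_le C ⟨fun i => (hmem i).1, ?_⟩ (iSup_le fun i => (hmem i).2)
  rw [← sUnion_range, ← hCr]
  exact hAS.trans (sUnion_mono (subset_insert _ _))

/-- A compact set of modified lower box dimension larger than `t` contains a non-empty compact set
all of whose non-empty relatively open portions have lower box dimension larger than `t`. -/
lemma exists_kernel [HereditarilyLindelofSpace X] {E : Set X} (hE : IsCompact E) {t : ℝ}
    (ht : (t : EReal) < modifiedLowerBoxDim E) :
    ∃ F ⊆ E, F.Nonempty ∧ IsCompact F ∧
      ∀ q ∈ F, ∀ ε > 0, (t : EReal) < lowerBoxDim (F ∩ Metric.closedBall q ε) := by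
  set F : Set X := {x ∈ E | ∀ U ∈ 𝓝[E] x, ¬ SigmaBoxDimLE t U} with hFdef
  have hFE : F ⊆ E := fun x hx => hx.1
  have hdiff : SigmaBoxDimLE t (E \ F) := by
    refine (HereditarilyLindelofSpace.isLindelof (E \ F)).induction_on
      (fun _ _ h => SigmaBoxDimLE.mono h)
      (fun S hS h => SigmaBoxDimLE.sUnion hS h) fun x hx => ?_
    obtain ⟨U, hU, hUs⟩ : ∃ U ∈ 𝓝[E] x, SigmaBoxDimLE t U := by
      by_contra! hcon
      exact hx.2 ⟨hx.1, hcon⟩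
    exact ⟨U, nhdsWithin_mono x sdiff_subset hU, hUs⟩
  have hclosed : IsClosed F := by
    refine isClosed_of_closure_subset fun x hx => ?_
    refine ⟨closure_minimal hFE hE.isClosed hx, fun U hU hUs => ?_⟩
    obtain ⟨V, hV, hxV, hVU⟩ := mem_nhdsWithin.mp hU
    obtain ⟨y, hyV, hyF⟩ := mem_closure_iff.mp hx V hV hxV
    exact hyF.2 (V ∩ E) (mem_nhdsWithin.mpr ⟨V, hV, hyV, Subset.rfl⟩) (hUs.mono hVU)
  refine ⟨F, hFE, ?_, hE.of_isClosed_subset hclosed hFE, fun q hq ε hε => ?_⟩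
  · by_contra hempty
    rw [not_nonempty_iff_eq_empty.mp hempty, sdiff_empty] at hdiff
    exact absurd ht hdiff.modifiedLowerBoxDim_le.not_gt
  -- Otherwise a neighbourhood of `q` in `E` would be covered by this portion together with `E \ F`,
  -- against `q ∈ F`.
  · by_contra! hle
    have hc : IsCompact (F ∩ Metric.closedBall q ε) :=
      (hE.of_isClosed_subset hclosed hFE).inter_right Metric.isClosed_closedBall
    refine hq.2 (Metric.closedBall q ε ∩ E)
      (inter_mem (mem_nhdsWithin_of_mem_nhds (Metric.closedBall_mem_nhds q hε))
        self_mem_nhdsWithin) (((sigmaBoxDimLE_of_isCompact hc hle).union hdiff).mono ?_)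
    rintro x ⟨hxq, hxE⟩
    by_cases hxF : x ∈ F
    · exact Or.inl ⟨hxF, hxq⟩
    · exact Or.inr ⟨hxE, hxF⟩

end Kernel

/-! ### Separated points near every point of the kernel -/

section Separated

variable {X : Type*} [MetricSpace X]

/-- Greedy choice: if fewer than `n` points could not be extended, the balls of radius `ρ` about
them would cover `A`. -/
lemma exists_separated_of_le_coverNum {A : Set X} {ρ : ℝ} (hρ : 0 ≤ ρ) {n : ℕ}
    (h : (n : ℕ∞) ≤ coverNum (2 * ρ) A) :
    ∃ f : Fin n → X, (∀ a, f a ∈ A) ∧ ∀ a b, a ≠ b → ρ < dist (f a) (f b) := by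
  classical
  suffices H : ∀ m ≤ n, ∃ T : Finset X, T.card = m ∧ ↑T ⊆ A ∧
      (T : Set X).Pairwise fun x y => ρ < dist x y by
    obtain ⟨T, hcard, hTA, hsep⟩ := H n le_rfl
    let e := (T.equivFinOfCardEq hcard).symm
    exact ⟨fun a => e a, fun a => hTA (e a).2, fun a b hab =>
      hsep (e a).2 (e b).2 fun h => hab (e.injective (Subtype.ext h))⟩
  intro m
  induction m with
  | zero => exact fun _ => ⟨∅, by simp⟩
  | succ m ih =>
    intro hm
    obtain ⟨T, hcard, hTA, hsep⟩ := ih (by lia)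
    obtain ⟨x, hxA, hx⟩ : ∃ x ∈ A, ∀ y ∈ T, ρ < dist x y := by
      by_contra! hcon
      have hle : coverNum (2 * ρ) A ≤ (T.image fun y => Metric.closedBall y ρ).card := by
        refine coverNum_le_card _ (fun V hV => ?_) fun x hx => ?_
        · obtain ⟨y, -, rfl⟩ := Finset.mem_image.mp hV
          refine Metric.ediam_le fun u hu v hv => ?_
          rw [edist_dist]
          refine ENNReal.ofReal_le_ofReal ?_
          have := dist_triangle_right u v y
          rw [Metric.mem_closedBall] at hu hv
          linarith
        · obtain ⟨y, hyT, hy⟩ := hcon x hx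
          exact mem_biUnion (Finset.mem_coe.mpr (Finset.mem_image_of_mem _ hyT))
            (Metric.mem_closedBall.mpr hy)
      have h1 : (n : ℕ∞) ≤ (T.image fun y => Metric.closedBall y ρ).card := h.trans hle
      have h2 : n ≤ (T.image fun y => Metric.closedBall y ρ).card := by exact_mod_cast h1
      have := Finset.card_image_le (s := T) (f := fun y => Metric.closedBall y ρ)
      lia
    have hxT : x ∉ T := fun hxT => by
      have := hx x hxT
      rw [dist_self] at this
      linarith
    refine ⟨insert x T, by rw [Finset.card_insert_of_notMem hxT, hcard], ?_, ?_⟩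
    · rw [Finset.coe_insert]
      exact insert_subset hxA hTA
    · rw [Finset.coe_insert]
      exact hsep.insert fun y hy _ => ⟨hx y hy, dist_comm x y ▸ hx y hy⟩

/-- Uniformity in `p` comes from finitely many balls of radius `δ / 2`: the one containing `p` lies
in the ball of radius `δ` about `p`. -/
lemma eventually_rpow_le_coverNum_inter_closedBall {F : Set X} (hF : IsCompact F) {t : ℝ}
    (hFt : ∀ q ∈ F, ∀ ε > 0, (t : EReal) < lowerBoxDim (F ∩ Metric.closedBall q ε)) {δ : ℝ}
    (hδ : 0 < δ) :
    ∀ᶠ r : ℝ in 𝓝[>] 0, ∀ p ∈ F, ENNReal.ofReal (r ^ (-t)) ≤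
      ((coverNum r (F ∩ Metric.closedBall p δ) : ℕ∞) : ENNReal) := by
  obtain ⟨T, hFT⟩ := hF.elim_nhds_subcover' (fun q _ => Metric.closedBall q (δ / 2))
    (fun q _ => Metric.closedBall_mem_nhds q (half_pos hδ))
  have hev := (T.eventually_all (l := 𝓝[>] (0 : ℝ))).mpr fun q _ =>
    eventually_rpow_lt_coverNum (hFt q q.2 _ (half_pos hδ))
  filter_upwards [hev] with r hr p hp
  obtain ⟨q, hqT, hpq⟩ := mem_iUnion₂.mp (hFT hp)
  refine (hr q hqT).le.trans (ENat.toENNReal_le.mpr (coverNum_mono ?_))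
  refine inter_subset_inter_right _ (Metric.closedBall_subset_closedBall' ?_)
  rw [dist_comm]
  linarith [Metric.mem_closedBall.mp hpq]

lemma eventually_two_mul_rpow_le {s t : ℝ} (hst : s < t) :
    ∀ᶠ r : ℝ in 𝓝[>] 0, 2 * (8 * r) ^ t ≤ r ^ s := by
  have h : Tendsto (fun r : ℝ => 2 * 8 ^ t * r ^ (t - s)) (𝓝[>] 0) (𝓝 0) := by
    have := ((Real.continuousAt_rpow_const 0 (t - s) (Or.inr (sub_pos.mpr hst).le)).tendsto).mono_left
      (nhdsWithin_le_nhds (s := Ioi 0))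
    rw [Real.zero_rpow (sub_pos.mpr hst).ne'] at this
    simpa using this.const_mul (2 * (8 : ℝ) ^ t)
  filter_upwards [h.eventually_le_const one_pos, self_mem_nhdsWithin] with r hr hr0
  have hr0 : 0 < r := hr0
  calc 2 * (8 * r) ^ t = (2 * 8 ^ t * r ^ (t - s)) * r ^ s := by
        rw [Real.mul_rpow (by norm_num) hr0.le, mul_assoc (2 * (8 : ℝ) ^ t), ← Real.rpow_add hr0]
        ring_nf
    _ ≤ 1 * r ^ s := by gcongr
    _ = r ^ s := one_mul _

/-- Around every point of `F` there are `N` points of `F` which are `4 r`-separated, with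
`2 / (N + 1) ≤ r ^ s`; the centre itself is listed first. -/
lemma eventually_exists_separated {F : Set X} (hF : IsCompact F) {s t : ℝ} (hst : s < t)
    (hFt : ∀ q ∈ F, ∀ ε > 0, (t : EReal) < lowerBoxDim (F ∩ Metric.closedBall q ε)) {δ : ℝ}
    (hδ : 0 < δ) :
    ∀ᶠ r : ℝ in 𝓝[>] 0, ∃ N : ℕ, 2 * ((N + 1 : ℕ) : ENNReal)⁻¹ ≤ ENNReal.ofReal (r ^ s) ∧
      ∃ f : X → Fin (N + 1) → X, ∀ p ∈ F, f p 0 = p ∧ (∀ a, f p a ∈ F ∧ dist (f p a) p ≤ δ) ∧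
        ∀ a b, a ≠ 0 → b ≠ 0 → a ≠ b → 4 * r < dist (f p a) (f p b) := by
  have h8 : Tendsto (fun r : ℝ => 8 * r) (𝓝[>] 0) (𝓝[>] 0) := by
    refine tendsto_nhdsWithin_iff.mpr ⟨?_, ?_⟩
    · have : Tendsto (fun r : ℝ => 8 * r) (𝓝 0) (𝓝 (8 * 0)) := tendsto_id.const_mul 8
      rw [mul_zero] at this
      exact this.mono_left nhdsWithin_le_nhds
    · filter_upwards [self_mem_nhdsWithin] with r hr
      exact mem_Ioi.mpr (mul_pos (by norm_num) hr)
  filter_upwards [h8.eventually (eventually_rpow_le_coverNum_inter_closedBall hF hFt hδ),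
    eventually_two_mul_rpow_le hst, self_mem_nhdsWithin] with r hcov hr hr0
  have hr0 : 0 < r := hr0
  have hpos : 0 < (8 * r) ^ (-t) := Real.rpow_pos_of_pos (by linarith) _
  -- The covering number at scale `8 r` yields `4 r`-separated points; the constants are absorbed by
  -- `s < t`.
  refine ⟨⌊(8 * r) ^ (-t)⌋₊, ?_, ?_⟩
  · rw [← ENNReal.ofReal_natCast, ← ENNReal.ofReal_inv_of_pos (by positivity),
      ← ENNReal.ofReal_ofNat 2, ← ENNReal.ofReal_mul (by norm_num)]
    refine ENNReal.ofReal_le_ofReal (le_trans ?_ hr)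
    gcongr
    rw [← inv_inv ((8 * r) ^ t), ← Real.rpow_neg (by linarith)]
    gcongr
    push_cast
    exact (Nat.lt_floor_add_one _).le
  · have hex : ∀ p ∈ F, ∃ f : Fin (⌊(8 * r) ^ (-t)⌋₊ + 1) → X, f 0 = p ∧
        (∀ a, f a ∈ F ∧ dist (f a) p ≤ δ) ∧
        ∀ a b, a ≠ 0 → b ≠ 0 → a ≠ b → 4 * r < dist (f a) (f b) := by
      intro p hp
      have hN : ((⌊(8 * r) ^ (-t)⌋₊ : ℕ) : ℕ∞) ≤
          coverNum (2 * (4 * r)) (F ∩ Metric.closedBall p δ) := by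
        rw [← ENat.toENNReal_le, ENat.toENNReal_coe, (by ring : 2 * (4 * r) = 8 * r),
          ← ENNReal.ofReal_natCast]
        exact (ENNReal.ofReal_le_ofReal (Nat.floor_le hpos.le)).trans (hcov p hp)
      obtain ⟨g, hg, hsep⟩ := exists_separated_of_le_coverNum (by linarith) hN
      -- The centre may be close to the other points, so index `0` is exempt from separation.
      refine ⟨Fin.cons p g, rfl, fun a => ?_, fun a b ha hb hab => ?_⟩
      · cases a using Fin.cases with
        | zero => simpa [hp] using hδ.le
        | succ a => simpa using hg a
      · obtain ⟨a, rfl⟩ := Fin.exists_succ_eq.mpr ha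
        obtain ⟨b, rfl⟩ := Fin.exists_succ_eq.mpr hb
        simpa using hsep a b fun h => hab (h ▸ rfl)
    choose! f hf using hex
    exact ⟨f, hf⟩

end Separated

/-! ### The random walk and the law of its limit -/

section RandomWalk

variable {X : Type*} {N : ℕ → ℕ}

/-- The position after `n` steps of a walk started at `p`, when the `i`-th step from `x` leads to
`f i x (ω i)`. -/
def walk (f : ∀ i, X → Fin (N i + 1) → X) (p : X) (ω : ∀ i, Fin (N i + 1)) : ℕ → X
  | 0 => p
  | n + 1 => f n (walk f p ω n) (ω n)

lemma walk_congr (f : ∀ i, X → Fin (N i + 1) → X) (p : X) {ω ω' : ∀ i, Fin (N i + 1)} {n : ℕ}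
    (h : ∀ i < n, ω i = ω' i) : walk f p ω n = walk f p ω' n := by
  induction n with
  | zero => rfl
  | succ n ih => rw [walk, walk, ih fun i hi => h i (by lia), h n (by lia)]

lemma walk_mem {f : ∀ i, X → Fin (N i + 1) → X} {F : Set X} (hf : ∀ i, ∀ p ∈ F, ∀ a, f i p a ∈ F)
    {p : X} (hp : p ∈ F) (ω : ∀ i, Fin (N i + 1)) (n : ℕ) : walk f p ω n ∈ F := by
  induction n with
  | zero => exact hp
  | succ n ih => exact hf n _ ih _

lemma walk_eq_start {f : ∀ i, X → Fin (N i + 1) → X} {p : X} (hf : ∀ i, f i p 0 = p)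
    {ω : ∀ i, Fin (N i + 1)} {n : ℕ} (h : ∀ i < n, ω i = 0) : walk f p ω n = p := by
  induction n with
  | zero => rfl
  | succ n ih => rw [walk, ih fun i hi => h i (by lia), h n (by lia), hf]

lemma isLocallyConstant_walk (f : ∀ i, X → Fin (N i + 1) → X) (p : X) (n : ℕ) :
    IsLocallyConstant fun ω => walk f p ω n := by
  induction n with
  | zero => exact IsLocallyConstant.const p
  | succ n ih =>
    exact ih.comp₂ ((IsLocallyConstant.iff_continuous _).mpr (continuous_apply n)) (f n)

/-- The law of independent choices, the `i`-th one uniform on `Fin (N i + 1)`. -/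
noncomputable def choiceLaw (N : ℕ → ℕ) : Measure (∀ i, Fin (N i + 1)) :=
  Measure.infinitePi fun i => (PMF.uniformOfFintype (Fin (N i + 1))).toMeasure

instance : IsProbabilityMeasure (choiceLaw N) := by
  rw [choiceLaw]
  infer_instance

/-- The factor `2` counts the choice `0` and at most one other. -/
lemma uniform_le_two_mul_inv {n : ℕ} {A : Set (Fin (n + 1))}
    (h : ∀ a ∈ A, ∀ b ∈ A, a ≠ 0 → b ≠ 0 → a = b) :
    (PMF.uniformOfFintype (Fin (n + 1))).toMeasure A ≤ 2 * ((n + 1 : ℕ) : ENNReal)⁻¹ := by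
  classical
  rw [PMF.toMeasure_uniformOfFintype_apply A A.to_countable.measurableSet, Fintype.card_fin,
    div_eq_mul_inv]
  gcongr
  have hsub : A.toFinset ⊆ insert 0 (A.toFinset.erase 0) := fun a ha => by
    by_cases h0 : a = 0
    · simp [h0]
    · exact Finset.mem_insert_of_mem (Finset.mem_erase.mpr ⟨h0, ha⟩)
  have hone : (A.toFinset.erase 0).card ≤ 1 := Finset.card_le_one.mpr fun a ha b hb => by
    simp only [Finset.mem_erase, mem_toFinset] at ha hb
    exact h a ha.2 b hb.2 ha.1 hb.1
  have := (Finset.card_le_card hsub).trans (Finset.card_insert_le _ _)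
  rw [toFinset_card] at this
  exact_mod_cast this.trans (by lia)

/-- A bound for the next choice that holds for every fixed history holds on average. -/
lemma choiceLaw_le_of_forall_history {n : ℕ} {c : ENNReal}
    (A : (∀ i, Fin (N i + 1)) → Set (Fin (N n + 1)))
    (hA : ∀ ω ω' : ∀ i, Fin (N i + 1), (∀ i < n, ω i = ω' i) → A ω = A ω')
    (hc : ∀ ω, (PMF.uniformOfFintype (Fin (N n + 1))).toMeasure (A ω) ≤ c) :
    choiceLaw N {ω | ω n ∈ A ω} ≤ c := by
  set P := choiceLaw N
  set H : (∀ i, Fin (N i + 1)) → ∀ i : Finset.range n, Fin (N i + 1) := (Finset.range n).restrict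
  have hH : Measurable H := Finset.measurable_restrict _
  have hn : Measurable fun ω : ∀ i, Fin (N i + 1) => ω n := measurable_pi_apply n
  have hind : ProbabilityTheory.IndepFun H (fun ω => ω n) P := by
    have h1 := (ProbabilityTheory.iIndepFun_infinitePi (P := fun i => (PMF.uniformOfFintype (Fin (N i + 1))).toMeasure)
      (X := fun _ x => x) (fun _ => measurable_id)).indepFun_finset (Finset.range n) {n}
      (by simp) (fun i => measurable_pi_apply i)
    have hproj : Measurable fun g : ∀ i : ({n} : Finset ℕ), Fin (N i + 1) =>
        g ⟨n, Finset.mem_singleton_self n⟩ := measurable_pi_apply _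
    exact h1.comp measurable_id hproj
  have hmap := (ProbabilityTheory.indepFun_iff_map_prod_eq_prod_map_map hH.aemeasurable hn.aemeasurable).mp hind
  have hlaw : P.map (fun ω => ω n) = (PMF.uniformOfFintype (Fin (N n + 1))).toMeasure :=
    Measure.infinitePi_map_eval _ n
  let S : Set ((∀ i : Finset.range n, Fin (N i + 1)) × Fin (N n + 1)) :=
    {z | ∃ ω, H ω = z.1 ∧ z.2 ∈ A ω}
  -- There are finitely many histories, so no measurability of `A` is needed.
  have hS : MeasurableSet S := S.to_countable.measurableSet
  have : IsProbabilityMeasure (P.map H) := Measure.isProbabilityMeasure_map hH.aemeasurable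
  calc P {ω | ω n ∈ A ω} ≤ P ((fun ω => (H ω, ω n)) ⁻¹' S) :=
        measure_mono fun ω hω => ⟨ω, rfl, hω⟩
    _ = ((P.map H).prod (P.map fun ω => ω n)) S := by
        rw [← hmap, Measure.map_apply (hH.prodMk hn) hS]
    _ = ∫⁻ h, (P.map fun ω => ω n) (Prod.mk h ⁻¹' S) ∂(P.map H) := Measure.prod_apply hS
    _ ≤ ∫⁻ _, c ∂(P.map H) := by
        refine lintegral_mono fun h => ?_
        rw [hlaw]
        by_cases hh : ∃ ω, H ω = h
        · obtain ⟨ω, rfl⟩ := hh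
          refine (measure_mono ?_).trans (hc ω)
          rintro a ⟨ω', hω', ha⟩
          rw [hA ω ω' fun i hi => (congrFun hω' ⟨i, Finset.mem_range.mpr hi⟩).symm]
          exact ha
        · have : Prod.mk h ⁻¹' S = ∅ :=
            eq_empty_of_forall_notMem fun a ⟨ω, hω, _⟩ => hh ⟨ω, hω⟩
          simp [this]
    _ = c := by simp

lemma choiceLaw_initial_zero_pos (n : ℕ) :
    0 < choiceLaw N {ω | ∀ i < n, ω i = 0} := by
  have hset : {ω : ∀ i, Fin (N i + 1) | ∀ i < n, ω i = 0}
      = Set.pi (Finset.range n) fun i => {(0 : Fin (N i + 1))} := by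
    ext ω
    simp
  rw [hset, choiceLaw, Measure.infinitePi_pi _ fun i _ => measurableSet_singleton _,
    pos_iff_ne_zero, Finset.prod_ne_zero_iff]
  intro i _
  rw [PMF.toMeasure_apply_singleton _ _ (measurableSet_singleton _)]
  simp

variable [MetricSpace X]

lemma exists_walk_limit {f : ∀ i, X → Fin (N i + 1) → X} {F : Set X} (hF : IsComplete F)
    {ρ : ℕ → ℝ} (hρ : ∀ i, ρ (i + 1) ≤ ρ i / 2)
    (hf : ∀ i, ∀ p ∈ F, ∀ a, f i p a ∈ F ∧ dist (f i p a) p ≤ ρ i / 2) {p : X} (hp : p ∈ F)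
    (ω : ∀ i, Fin (N i + 1)) :
    ∃ x ∈ F, Tendsto (walk f p ω) atTop (𝓝 x) ∧ ∀ i, dist (walk f p ω i) x ≤ ρ i := by
  have hmem := walk_mem (fun i p hp a => (hf i p hp a).1) hp ω
  have hgeom : ∀ i j, ρ (j + i) ≤ ρ i / 2 ^ j := by
    intro i j
    induction j with
    | zero => simp
    | succ j ih =>
      rw [pow_succ, ← div_div, (by ring : j + 1 + i = j + i + 1)]
      exact (hρ _).trans (by linarith)
  have hstep : ∀ i j, dist (walk f p ω (j + i)) (walk f p ω (j + 1 + i)) ≤ ρ i / 2 / 2 ^ j := by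
    intro i j
    rw [(by ring : j + 1 + i = j + i + 1), dist_comm]
    refine ((hf (j + i) _ (hmem _) _).2).trans ?_
    rw [div_right_comm]
    linarith [hgeom i j]
  obtain ⟨x, hx, hlim⟩ := cauchySeq_tendsto_of_isComplete hF hmem
    (cauchySeq_of_le_geometric_two (hstep 0))
  refine ⟨x, hx, hlim, fun i => ?_⟩
  simpa using dist_le_of_le_geometric_two_of_tendsto₀ (hstep i) ((tendsto_add_atTop_iff_nat i).mpr hlim)

variable [MeasurableSpace X] [BorelSpace X]

/-- The law of the limit of the walk, a probability measure carried by `F` whose masses of balls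
are controlled by the numbers of choices. -/
lemma exists_measure_of_separated {f : ∀ i, X → Fin (N i + 1) → X} {F : Set X} (hF : IsCompact F)
    {ρ : ℕ → ℝ} (hρ : ∀ i, ρ (i + 1) ≤ ρ i / 2) (hρ0 : Tendsto ρ atTop (𝓝 0))
    (hf : ∀ i, ∀ p ∈ F, f i p 0 = p ∧ (∀ a, f i p a ∈ F ∧ dist (f i p a) p ≤ ρ i / 2) ∧
      ∀ a b, a ≠ 0 → b ≠ 0 → a ≠ b → 4 * ρ (i + 1) < dist (f i p a) (f i p b))
    {p : X} (hp : p ∈ F) :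
    ∃ μ : Measure X, μ Fᶜ = 0 ∧ p ∈ μ.support ∧
      ∀ x i, μ (Metric.closedBall x (ρ (i + 1))) ≤ 2 * ((N i + 1 : ℕ) : ENNReal)⁻¹ := by
  choose Y hYF hYlim hYdist using
    exists_walk_limit hF.isComplete hρ (fun i p hp => (hf i p hp).2.1) hp
  have hmem := walk_mem (fun i p hp a => ((hf i p hp).2.1 a).1) hp
  have hY : Measurable Y :=
    measurable_of_tendsto_metrizable (fun n => (isLocallyConstant_walk f p n).continuous.measurable)
      (tendsto_pi_nhds.mpr hYlim)
  refine ⟨(choiceLaw N).map Y, ?_, ?_, fun x i => ?_⟩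
  · rw [Measure.map_apply hY hF.isClosed.measurableSet.compl]
    convert measure_empty (μ := choiceLaw N)
    exact eq_empty_of_forall_notMem fun ω hω => hω (hYF ω)
  -- With positive probability the walk rests at `p` for `n` steps, and its limit is then within `ρ
  -- n` of `p`.
  · refine (Measure.mem_support_iff_forall p).mpr fun U hU => ?_
    obtain ⟨ε, hε, hεU⟩ := Metric.mem_nhds_iff.mp hU
    obtain ⟨n, hn⟩ := (hρ0.eventually_lt_const hε).exists
    refine lt_of_lt_of_le ?_ (measure_mono hεU)
    rw [Measure.map_apply hY Metric.isOpen_ball.measurableSet]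
    refine (choiceLaw_initial_zero_pos n).trans_le (measure_mono fun ω hω => ?_)
    have h1 := hYdist ω n
    rw [walk_eq_start (fun i => (hf i p hp).1) hω, dist_comm] at h1
    exact Metric.mem_ball.mpr (h1.trans_lt hn)
  · rw [Measure.map_apply hY Metric.isClosed_closedBall.measurableSet]
    -- After step `i` the walk is within `ρ (i + 1)` of its limit, so a limit in the ball forces a
    -- choice in `A ω`. Separation by `4 * ρ (i + 1)` leaves at most one non-zero such choice.
    let A : (∀ i, Fin (N i + 1)) → Set (Fin (N i + 1)) := fun ω =>
      {a | dist (f i (walk f p ω i) a) x ≤ 2 * ρ (i + 1)}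
    refine (measure_mono (t := {ω | ω i ∈ A ω}) fun ω hω => ?_).trans
      (choiceLaw_le_of_forall_history A (fun ω ω' h => ?_) fun ω =>
        uniform_le_two_mul_inv fun a ha b hb ha0 hb0 => ?_)
    · have h1 : dist (walk f p ω (i + 1)) (Y ω) ≤ ρ (i + 1) := hYdist ω (i + 1)
      have h2 : dist (Y ω) x ≤ ρ (i + 1) := hω
      have h3 := dist_triangle (walk f p ω (i + 1)) (Y ω) x
      change dist (walk f p ω (i + 1)) x ≤ _
      linarith
    · simp only [A, walk_congr f p h]
    · by_contra hab
      have h1 := (hf i _ (hmem ω i)).2.2 a b ha0 hb0 hab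
      have h2 := dist_triangle_right (f i (walk f p ω i) a) (f i (walk f p ω i) b) x
      have ha' : dist (f i (walk f p ω i) a) x ≤ 2 * ρ (i + 1) := ha
      have hb' : dist (f i (walk f p ω i) b) x ≤ 2 * ρ (i + 1) := hb
      linarith

end RandomWalk

/-! ### Frostman measures with prescribed support -/

section Frostman

variable {X : Type*} [MetricSpace X] [MeasurableSpace X] [BorelSpace X]

/-- A convex combination over a dense sequence of `F` keeps the bounds `c i`, and its closed support
contains that sequence. -/
lemma exists_measure_support_eq {F : Set X} (hF : IsCompact F) (hne : F.Nonempty)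
    {B : ℕ → X → Set X} (hB : ∀ i x, MeasurableSet (B i x)) {c : ℕ → ENNReal}
    (h : ∀ p ∈ F, ∃ μ : Measure X, μ Fᶜ = 0 ∧ p ∈ μ.support ∧ ∀ x i, μ (B i x) ≤ c i) :
    ∃ μ : Measure X, μ.support = F ∧ ∀ x i, μ (B i x) ≤ c i := by
  choose! m hmF hmp hmB using h
  have : CompactSpace F := isCompact_iff_compactSpace.mp hF
  have : Nonempty F := hne.to_subtype
  let q : ℕ → X := fun n => TopologicalSpace.denseSeq F n
  have hq : ∀ n, q n ∈ F := fun n => (TopologicalSpace.denseSeq F n).2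
  let w : ℕ → ENNReal := fun n => 2⁻¹ ^ (n + 1)
  have hw : ∑' n, w n = 1 := by
    rw [ENNReal.tsum_geometric_add_one, ENNReal.one_sub_inv_two, inv_inv]
    exact ENNReal.inv_mul_cancel (by norm_num) (by norm_num)
  let μ := Measure.sum fun n => w n • m (q n)
  refine ⟨μ, Subset.antisymm ?_ ?_, fun x i => ?_⟩
  · refine Measure.support_subset_of_isClosed hF.isClosed ?_
    rw [mem_ae_iff, Measure.sum_apply _ hF.isClosed.measurableSet.compl]
    simp [hmF _ (hq _)]
  · have hsupp : ∀ n, q n ∈ μ.support := fun n => by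
      refine (Measure.mem_support_iff_forall _).mpr fun U hU => ?_
      have h1 := (Measure.mem_support_iff_forall _).mp (hmp _ (hq n)) U hU
      refine lt_of_lt_of_le ?_ (Measure.le_sum (fun n => w n • m (q n)) n U)
      exact ENNReal.mul_pos (by simp [w]) h1.ne'
    intro x hx
    have hd := TopologicalSpace.denseRange_denseSeq F ⟨x, hx⟩
    refine closure_minimal ?_ Measure.isClosed_support
      (image_closure_subset_closure_image continuous_subtype_val (mem_image_of_mem _ hd))
    rintro _ ⟨_, ⟨n, rfl⟩, rfl⟩
    exact hsupp n
  · rw [Measure.sum_apply _ (hB i x)]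
    calc ∑' n, (w n • m (q n)) (B i x) ≤ ∑' n, w n * c i := by
          refine ENNReal.tsum_le_tsum fun n => ?_
          rw [Measure.smul_apply, smul_eq_mul]
          gcongr
          exact hmB _ (hq n) x i
      _ = c i := by rw [ENNReal.tsum_mul_right, hw, one_mul]

/-- Along a subsequence of any sequence of scales, a compact set all of whose portions have lower
box dimension larger than `s` is the support of a measure satisfying a Frostman condition. -/
theorem exists_subseq_frostman_measure {F : Set X} (hF : IsCompact F) (hne : F.Nonempty) {s t : ℝ}
    (hst : s < t)
    (hFt : ∀ q ∈ F, ∀ ε > 0, (t : EReal) < lowerBoxDim (F ∩ Metric.closedBall q ε))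
    {r : ℕ → ℝ} (hr : DecreasesToZero r) :
    ∃ φ : ℕ → ℕ, StrictMono φ ∧ ∃ μ : Measure X, μ.support = F ∧
      ∀ x i, μ (Metric.closedBall x (r (φ i))) ≤ ENNReal.ofReal (r (φ i) ^ s) := by
  have hnext : ∀ m : ℕ, ∃ n, m < n ∧ r n ≤ r m / 2 ∧
      ∃ N : ℕ, 2 * ((N + 1 : ℕ) : ENNReal)⁻¹ ≤ ENNReal.ofReal (r n ^ s) ∧
        ∃ f : X → Fin (N + 1) → X, ∀ p ∈ F, f p 0 = p ∧
          (∀ a, f p a ∈ F ∧ dist (f p a) p ≤ r m / 2) ∧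
          ∀ a b, a ≠ 0 → b ≠ 0 → a ≠ b → 4 * r n < dist (f p a) (f p b) := fun m =>
    ((eventually_gt_atTop m).and ((hr.2.2.eventually_le_const (half_pos (hr.1 m))).and
      (hr.tendsto_nhdsGT.eventually
        (eventually_exists_separated hF hst hFt (half_pos (hr.1 m)))))).exists
  choose next hlt hhalf N hN f hf using hnext
  let ψ : ℕ → ℕ := fun i => next^[i] 0
  have hψ : ∀ i, ψ (i + 1) = next (ψ i) := fun i => Function.iterate_succ_apply' next i 0
  have hmono : StrictMono ψ := strictMono_nat_of_lt_succ fun i => hψ i ▸ hlt (ψ i)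
  -- The shift arises because step `i`, of length at most `r (ψ i) / 2`, controls balls of radius `r
  -- (ψ (i + 1))`.
  refine ⟨fun i => ψ (i + 1), hmono.comp (strictMono_nat_of_lt_succ fun i => Nat.lt_succ_self _), ?_⟩
  obtain ⟨μ, hμ, hball⟩ := exists_measure_support_eq hF hne
    (B := fun i x => Metric.closedBall x (r (ψ (i + 1))))
    (c := fun i => 2 * ((N (ψ i) + 1 : ℕ) : ENNReal)⁻¹)
    (fun i x => Metric.isClosed_closedBall.measurableSet) fun p hp =>
      exists_measure_of_separated (N := fun i => N (ψ i)) (f := fun i => f (ψ i)) (F := F)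
        (ρ := fun i => r (ψ i)) hF (fun i => by simpa only [hψ] using hhalf (ψ i))
        (hr.2.2.comp hmono.tendsto_atTop)
        (fun i => by simpa only [hψ] using hf (ψ i)) hp
  refine ⟨μ, hμ, fun x i => (hball x i).trans ?_⟩
  simpa only [hψ] using hN (ψ i)

end Frostman

/-! ### The cycle of inequalities -/

variable {X : Type*} [MetricSpace X] [MeasurableSpace X]

lemma support_dirac_eq [OpensMeasurableSpace X] (p : X) : (Measure.dirac p).support = {p} := by
  refine Subset.antisymm
    (Measure.support_subset_of_isClosed isClosed_singleton ?_) (singleton_subset_iff.mpr ?_)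
  · rw [mem_ae_iff, Measure.dirac_apply' _ (measurableSet_singleton p).compl]
    simp
  · refine (Measure.mem_support_iff_forall p).mpr fun U hU => ?_
    rw [Measure.dirac_apply_of_mem (mem_of_mem_nhds hU)]
    exact one_pos

/-- The Frostman exponents of `E`: those `s ≥ 0` for which some non-empty `F ⊆ E` is, along a
subsequence of any sequence of scales, the support of a measure with `μ (B(x, r)) ≤ r ^ s`. -/
def frostmanExponents (E : Set X) : Set ℝ :=
  {s : ℝ | 0 ≤ s ∧ ∃ F : Set X, F ⊆ E ∧ F.Nonempty ∧
    ∀ r : ℕ → ℝ, DecreasesToZero r →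
      ∃ φ : ℕ → ℕ, StrictMono φ ∧
        ∃ μ : Measure X, μ.support = F ∧
          ∀ (x : X) (i : ℕ), μ (Metric.closedBall x (r (φ i))) ≤ ENNReal.ofReal (r (φ i) ^ s)}

/-- The supremum over non-empty `F ⊆ E` of the local dimensions of measures supported on `F`. -/
noncomputable def supLocalDim (E : Set X) : EReal :=
  ⨆ (F : Set X) (_ : F ⊆ E ∧ F.Nonempty),
    ⨅ (r : ℕ → ℝ) (_ : DecreasesToZero r),
      ⨆ (μ : Measure X) (_ : μ.support = F),
        limsup (fun k : ℕ => ⨅ x ∈ E,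
          ENNReal.log (μ (Metric.closedBall x (r k))) / ((Real.log (r k) : ℝ) : EReal))
          atTop

/-- A point mass shows that the supremum is at least `0` for non-empty `E`, so any real above it
meets the requirement `0 ≤ s`. -/
lemma zero_mem_frostmanExponents [OpensMeasurableSpace X] {E : Set X} (hE : E.Nonempty) :
    (0 : ℝ) ∈ frostmanExponents E := by
  obtain ⟨p, hp⟩ := hE
  refine ⟨le_rfl, {p}, singleton_subset_iff.mpr hp, singleton_nonempty p, fun r _ =>
    ⟨id, strictMono_id, Measure.dirac p, support_dirac_eq p, fun x i => ?_⟩⟩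
  rw [Real.rpow_zero, ENNReal.ofReal_one]
  exact prob_le_one

lemma modifiedLowerBoxDim_le_sSup_frostmanExponents [BorelSpace X] [HereditarilyLindelofSpace X]
    {E : Set X} (hE : IsCompact E) :
    modifiedLowerBoxDim E ≤ sSup ((fun s : ℝ => (s : EReal)) '' frostmanExponents E) := by
  rcases E.eq_empty_or_nonempty with rfl | hne
  · rw [modifiedLowerBoxDim_empty]
    exact bot_le
  have h0 : (0 : EReal) ≤ sSup ((fun s : ℝ => (s : EReal)) '' frostmanExponents E) :=
    le_sSup ⟨0, zero_mem_frostmanExponents hne, rfl⟩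
  by_contra! hlt
  obtain ⟨s, hs, hsM⟩ := EReal.lt_iff_exists_real_btwn.mp hlt
  obtain ⟨t, hst, htM⟩ := EReal.lt_iff_exists_real_btwn.mp hsM
  obtain ⟨F, hFE, hFne, hF, hFt⟩ := exists_kernel hE htM
  have hs0 : (0 : ℝ) ≤ s := by exact_mod_cast h0.trans hs.le
  refine hs.not_ge (le_sSup ⟨s, ⟨hs0, F, hFE, hFne, fun r hr => ?_⟩, rfl⟩)
  exact exists_subseq_frostman_measure hF hFne (by exact_mod_cast hst) hFt hr

lemma sSup_frostmanExponents_le_supLocalDim (E : Set X) :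
    sSup ((fun s : ℝ => (s : EReal)) '' frostmanExponents E) ≤ supLocalDim E := by
  refine sSup_le ?_
  rintro _ ⟨s, ⟨-, F, hFE, hne, h⟩, rfl⟩
  refine le_iSup₂_of_le F ⟨hFE, hne⟩ (le_iInf₂ fun r hr => ?_)
  obtain ⟨φ, hφ, μ, hμ, hball⟩ := h r hr
  refine le_iSup₂_of_le μ hμ (le_limsup_of_frequently_le ?_)
  have hlt : ∀ᶠ k in atTop, r k < 1 := hr.2.2.eventually_lt_const one_pos
  refine hφ.tendsto_atTop.frequently (Eventually.frequently ?_)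
  filter_upwards [hφ.tendsto_atTop.eventually hlt] with i hi
  exact le_iInf₂ fun x _ => (le_log_div_log_iff (hr.1 _) hi).mpr (hball x i)

lemma supLocalDim_le_modifiedLowerBoxDim [HereditarilyLindelofSpace X] {E : Set X}
    (hE : IsCompact E) : supLocalDim E ≤ modifiedLowerBoxDim E := by
  refine iSup₂_le fun F hF => ?_
  by_contra! hlt
  obtain ⟨s, hs, hsF⟩ := EReal.lt_iff_exists_real_btwn.mp hlt
  refine hs.not_ge (le_modifiedLowerBoxDim hE hF.1 hF.2 fun r hr => ?_)
  obtain ⟨μ, hsμ⟩ := lt_iSup_iff.mp (hsF.trans_le (iInf₂_le r hr))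
  obtain ⟨hμ, hsμ⟩ := lt_iSup_iff.mp hsμ
  refine ⟨μ, hμ, ((frequently_lt_of_lt_limsup (by isBoundedDefault) hsμ).and_eventually
    (hr.2.2.eventually_lt_const one_pos)).mono fun k hk x hx => ?_⟩
  exact (le_log_div_log_iff (hr.1 k) hk.2).mp (hk.1.le.trans (iInf₂_le x hx))

end ModifiedBoxDim

theorem mainTheorem1 (d : ℕ) (E : Set (EuclideanSpace ℝ (Fin d))) (hE : IsCompact E) :
    modifiedLowerBoxDim E =
        sSup ((fun s : ℝ => (s : EReal)) ''
          {s : ℝ | 0 ≤ s ∧ ∃ F : Set (EuclideanSpace ℝ (Fin d)), F ⊆ E ∧ F.Nonempty ∧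
            ∀ r : ℕ → ℝ, DecreasesToZero r →
              ∃ φ : ℕ → ℕ, StrictMono φ ∧
                ∃ μ : Measure (EuclideanSpace ℝ (Fin d)), μ.support = F ∧
                  ∀ (x : EuclideanSpace ℝ (Fin d)) (i : ℕ),
                    μ (Metric.closedBall x (r (φ i))) ≤ ENNReal.ofReal (r (φ i) ^ s)}) ∧
      modifiedLowerBoxDim E =
        ⨆ (F : Set (EuclideanSpace ℝ (Fin d))) (_ : F ⊆ E ∧ F.Nonempty),
          ⨅ (r : ℕ → ℝ) (_ : DecreasesToZero r),
            ⨆ (μ : Measure (EuclideanSpace ℝ (Fin d))) (_ : μ.support = F),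
              limsup (fun k : ℕ => ⨅ x ∈ E,
                ENNReal.log (μ (Metric.closedBall x (r k))) / ((Real.log (r k) : ℝ) : EReal))
                atTop := by
  have h1 := ModifiedBoxDim.modifiedLowerBoxDim_le_sSup_frostmanExponents hE
  have h2 := ModifiedBoxDim.sSup_frostmanExponents_le_supLocalDim E
  have h3 := ModifiedBoxDim.supLocalDim_le_modifiedLowerBoxDim hE
  exact ⟨h1.antisymm (h2.trans h3), (h1.trans h2).antisymm h3⟩
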